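/- Let $\mathcal B$ be a small category and let $\mathcal G=\mathrm{Set}^{\mathcal B}$ be the category of covariant functors $\mathcal B\to\mathrm{Set}$. Let $I$ be a (small) directed multigraph with vertex set $I_0$ and edge set $I_1$, and let $D$ be a diagram of shape $I$ in $\mathcal G$, that is, a graph morphism from $I$ to the underlying graph of $\mathcal G$: it has objects $D_i$ ($i\in I_0$) and morphisms $D_d:D_i\to D_j$ for the edges $d:i\to j$. Diagrams of shape $I$ with natural transformations (families $\tau_i:E_i\to D_i$ with $\tau_j\circ E_d=D_d\circ\tau_i$ for every edge $d:i\to j$) form a category $\mathcal G^I$. A natural transformation is *cartesian* if all its naturality squares are pullbacks, and $\mathcal G^I\Downarrow D$ denotes the full subcategory of the slice category $\mathcal G^I\downarrow D$ on the cartesian transformations into $D$. Let $\Delta S$ be the constant diagram at $S\in\mathcal G$, and let $\kappa:D\Rightarrow\Delta S$ be a colimiting (i.e. universal) cocone. Taking pullbacks along all the components $\kappa_i:D_i\to S$ defines a functor $\kappa^*:\mathcal G\downarrow S\to\mathcal G^I\Downarrow D$. The cocone $\kappa$ is *Van Kampen* if $\kappa^*$ is an equivalence of categories. For an object $X$ of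 $\mathcal B$, a *path segment* of sort $X$ is a triple $(y,\delta,y')$ in which $y,y'$ are elements of the disjoint union $\coprod_{i\in I_0}D_i(X)$ and either $\delta=d$ is an edge $d:i\to j$ with $y\in D_i(X)$ and $y'=(D_d)_X(y)\in D_j(X)$, or $\delta=d^{op}$ is the formal opposite of an edge $d:i\to j$ with $y'\in D_i(X)$ and $y=(D_d)_X(y')\in D_j(X)$. Two segments are *weakly equal* if they are equal or one is the reverse $(y',\delta^{op},y)$ of the other $(y,\delta,y')$, where $(d^{op})^{op}=d$. A *mapping path* of sort $X$ connecting $z$ with $z'$ is a finite sequence of segments $[(y_0,\delta_0,y_1),(y_1,\delta_1,y_2),\dots,(y_{n-1},\delta_{n-1},y_n)]$ with $y_0=z$ and $y_n=z'$; the empty sequence connects every element with itself. A mapping path is *proper* if no two of its segments at different positions are weakly equal. Two mapping paths are equal if they have the same length and agree segment by segment. **Theorem.** The colimiting cocone $\kappa:D\Rightarrow\Delta S$ is Van Kampen if and only if for all objects $X$ of $\mathcal B$, all $i,j\in I_0$ and all $z\in D_i(X)$, $z'\in D_j(X)$, there are no two different proper mapping paths in $D$ connecting $z$ and $z'$. 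-/

import Mathlib

universe w v u v₁ u₁

open CategoryTheory CategoryTheory.Limits

noncomputable section

namespace VKPath

section Diagrams

variable (I : Type u₁) [Quiver.{v₁} I] (C : Type u) [Category.{v} C]

/-- A diagram of shape the directed multigraph `I` in `C`: a graph morphism from `I` to the
underlying graph of `C`. -/
structure Diagram extends Prefunctor I C

variable {I C}

/-- A natural transformation between diagrams. -/
@[ext]
structure DiagramHom (E D : Diagram I C) where
  app : ∀ i : I, E.obj i ⟶ D.obj i
  naturality : ∀ {i j : I} (d : i ⟶ j), E.map d ≫ app j = app i ≫ D.map d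

/-- The category of diagrams of shape `I` in `C`. -/
instance : Category (Diagram I C) where
  Hom E D := DiagramHom E D
  id D := { app := fun i => 𝟙 (D.obj i), naturality := by simp }
  comp f g :=
    { app := fun i => f.app i ≫ g.app i
      naturality := fun d => by
        rw [← Category.assoc, f.naturality, Category.assoc, g.naturality, Category.assoc] }
  id_comp f := DiagramHom.ext (funext fun _ => Category.id_comp _)
  comp_id f := DiagramHom.ext (funext fun _ => Category.comp_id _)
  assoc f g h := DiagramHom.ext (funext fun _ => Category.assoc _ _ _)

/-- The constant diagram functor. -/
def constDiagram : C ⥤ Diagram I C where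
  obj S := { obj := fun _ => S, map := fun _ => 𝟙 S }
  map f := { app := fun _ => f, naturality := fun _ => by simp }
  map_id _ := rfl
  map_comp _ _ := rfl

/-- A natural transformation is cartesian if all its naturality squares are pullbacks. -/
def IsCartesian {E D : Diagram I C} (τ : E ⟶ D) : Prop :=
  ∀ ⦃i j : I⦄ (d : i ⟶ j), IsPullback (E.map d) (τ.app i) (τ.app j) (D.map d)

/-- The full subcategory of the slice over `D` on the cartesian natural transformations. -/
abbrev CartesianOver (D : Diagram I C) :=
  ObjectProperty.FullSubcategory (fun τ : Over D => IsCartesian τ.hom)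

variable {D : Diagram I C} {S : C}

/-- The component of a commutative cocone at `i`. -/
def leg (κ : D ⟶ constDiagram.obj S) (i : I) : D.obj i ⟶ S := κ.app i

theorem map_leg (κ : D ⟶ constDiagram.obj S) {i j : I} (d : i ⟶ j) :
    D.map d ≫ leg κ j = leg κ i :=
  (κ.naturality d).trans (Category.comp_id (leg κ i))

/-- A commutative cocone is colimiting if it is universal. -/
def IsColimiting (κ : D ⟶ constDiagram.obj S) : Prop :=
  ∀ (T : C) (ρ : D ⟶ constDiagram.obj T), ∃! u : S ⟶ T, κ ≫ constDiagram.map u = ρ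

variable [HasPullbacks C]

/-- The morphism between the pullbacks of `σ` along `κ_i` and `κ_j` induced by an edge. -/
def pullbackEdge (κ : D ⟶ constDiagram.obj S) (σ : Over S) {i j : I} (d : i ⟶ j) :
    pullback (leg κ i) σ.hom ⟶ pullback (leg κ j) σ.hom :=
  pullback.lift (pullback.fst (leg κ i) σ.hom ≫ D.map d) (pullback.snd (leg κ i) σ.hom)
    (by rw [Category.assoc, map_leg, pullback.condition])

@[simp]
theorem pullbackEdge_fst (κ : D ⟶ constDiagram.obj S) (σ : Over S) {i j : I} (d : i ⟶ j) :
    pullbackEdge κ σ d ≫ pullback.fst (leg κ j) σ.hom = pullback.fst (leg κ i) σ.hom ≫ D.map d :=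
  pullback.lift_fst _ _ _

@[simp]
theorem pullbackEdge_snd (κ : D ⟶ constDiagram.obj S) (σ : Over S) {i j : I} (d : i ⟶ j) :
    pullbackEdge κ σ d ≫ pullback.snd (leg κ j) σ.hom = pullback.snd (leg κ i) σ.hom :=
  pullback.lift_snd _ _ _

/-- The morphism between the pullbacks of `σ` and `σ'` along `κ_i` induced by `γ : σ ⟶ σ'`. -/
def pullbackComp (κ : D ⟶ constDiagram.obj S) {σ σ' : Over S} (γ : σ ⟶ σ') (i : I) :
    pullback (leg κ i) σ.hom ⟶ pullback (leg κ i) σ'.hom :=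
  pullback.lift (pullback.fst (leg κ i) σ.hom) (pullback.snd (leg κ i) σ.hom ≫ γ.left)
    (by rw [Category.assoc, Over.w γ, pullback.condition])

@[simp]
theorem pullbackComp_fst (κ : D ⟶ constDiagram.obj S) {σ σ' : Over S} (γ : σ ⟶ σ') (i : I) :
    pullbackComp κ γ i ≫ pullback.fst (leg κ i) σ'.hom = pullback.fst (leg κ i) σ.hom :=
  pullback.lift_fst _ _ _

@[simp]
theorem pullbackComp_snd (κ : D ⟶ constDiagram.obj S) {σ σ' : Over S} (γ : σ ⟶ σ') (i : I) :
    pullbackComp κ γ i ≫ pullback.snd (leg κ i) σ'.hom =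
      pullback.snd (leg κ i) σ.hom ≫ γ.left :=
  pullback.lift_snd _ _ _

/-- The diagram obtained by pulling back `σ : K ⟶ S` along all components of a cocone. -/
def pullbackDiagram (κ : D ⟶ constDiagram.obj S) (σ : Over S) : Diagram I C where
  obj i := pullback (leg κ i) σ.hom
  map d := pullbackEdge κ σ d

/-- The projections of the pulled back diagram to `D`. -/
def pullbackProj (κ : D ⟶ constDiagram.obj S) (σ : Over S) : pullbackDiagram κ σ ⟶ D where
  app i := pullback.fst (leg κ i) σ.hom
  naturality d := pullbackEdge_fst κ σ d

theorem isCartesian_pullbackProj (κ : D ⟶ constDiagram.obj S) (σ : Over S) :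
    IsCartesian (pullbackProj κ σ) := by
  intro i j d
  have hj := (IsPullback.of_hasPullback (leg κ j) σ.hom).flip
  have hi : IsPullback (pullbackEdge κ σ d ≫ pullback.snd (leg κ j) σ.hom)
      (pullback.fst (leg κ i) σ.hom) σ.hom (D.map d ≫ leg κ j) := by
    rw [pullbackEdge_snd, map_leg]
    exact (IsPullback.of_hasPullback (leg κ i) σ.hom).flip
  exact IsPullback.of_right hi (pullbackEdge_fst κ σ d) hj

/-- The natural transformation between pulled back diagrams induced by `γ : σ ⟶ σ'`. -/
def pullbackMap (κ : D ⟶ constDiagram.obj S) {σ σ' : Over S} (γ : σ ⟶ σ') :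
    pullbackDiagram κ σ ⟶ pullbackDiagram κ σ' where
  app i := pullbackComp κ γ i
  naturality {i j} d := by
    change pullbackEdge κ σ d ≫ pullbackComp κ γ j = pullbackComp κ γ i ≫ pullbackEdge κ σ' d
    apply pullback.hom_ext
    · rw [Category.assoc, Category.assoc, pullbackComp_fst, pullbackEdge_fst, pullbackEdge_fst,
        ← Category.assoc, pullbackComp_fst]
    · rw [Category.assoc, Category.assoc, pullbackComp_snd, pullbackEdge_snd, pullbackComp_snd,
        ← Category.assoc, pullbackEdge_snd]

/-- The functor that pulls back along all components of the cocone `κ`, from the slice over `S`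
to the cartesian natural transformations into `D`. -/
def pullbackFunctor (κ : D ⟶ constDiagram.obj S) : Over S ⥤ CartesianOver D where
  obj σ := ⟨Over.mk (pullbackProj κ σ), isCartesian_pullbackProj κ σ⟩
  map γ := ObjectProperty.homMk <| Over.homMk (pullbackMap κ γ)
    (DiagramHom.ext (funext fun i => pullbackComp_fst κ γ i))
  map_id σ := by
    apply ObjectProperty.hom_ext
    apply Over.OverMorphism.ext
    refine DiagramHom.ext (funext fun i => ?_)
    change pullbackComp κ (𝟙 σ) i = 𝟙 (pullback (leg κ i) σ.hom)
    apply pullback.hom_ext <;> simp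
  map_comp {σ σ' σ''} γ γ' := by
    apply ObjectProperty.hom_ext
    apply Over.OverMorphism.ext
    refine DiagramHom.ext (funext fun i => ?_)
    change pullbackComp κ (γ ≫ γ') i = pullbackComp κ γ i ≫ pullbackComp κ γ' i
    apply pullback.hom_ext
    · simp
    · rw [Category.assoc, pullbackComp_snd, pullbackComp_snd,
        ← Category.assoc, pullbackComp_snd, Category.assoc, Over.comp_left]

/-- A cocone is Van Kampen if pulling back along it is an equivalence of categories. -/
def IsVanKampen (κ : D ⟶ constDiagram.obj S) : Prop :=
  (pullbackFunctor κ).IsEquivalence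

end Diagrams

section MappingPaths

variable {B : Type w} [SmallCategory B] {I : Type w} [Quiver.{w} I]

/-- The disjoint union over `i` of the elements of sort `X` of the components `D_i`. -/
abbrev Elem (D : Diagram I (B ⥤ Type w)) (X : B) : Type w := Σ i : I, (D.obj i).obj X

/-- A path segment `(y, δ, y')` of sort `X`. The label `δ` is an edge `d` (`Sum.inl d`) or a
formal opposite `dᵒᵖ` of an edge (`Sum.inr d`). -/
structure PathSegment (D : Diagram I (B ⥤ Type w)) (X : B) where
  source : Elem D X
  label : Quiver.Total I ⊕ Quiver.Total I
  target : Elem D X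
  valid : match label with
    | Sum.inl d => ∃ x : (D.obj d.left).obj X,
        source = ⟨d.left, x⟩ ∧ target = ⟨d.right, (D.map d.hom).app X x⟩
    | Sum.inr d => ∃ x : (D.obj d.left).obj X,
        target = ⟨d.left, x⟩ ∧ source = ⟨d.right, (D.map d.hom).app X x⟩

variable {D : Diagram I (B ⥤ Type w)} {X : B}

/-- Weak equality: equal, or equal up to reversal. -/
def PathSegment.WeakEq (s t : PathSegment D X) : Prop :=
  s = t ∨ (s.source = t.target ∧ s.label = t.label.swap ∧ s.target = t.source)

/-- `Connects z P z'`: the sequence `P` of segments is a mapping path connecting `z` with `z'`. -/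
def Connects (z : Elem D X) : List (PathSegment D X) → Elem D X → Prop
  | [], z' => z = z'
  | s :: P, z' => s.source = z ∧ Connects s.target P z'

/-- A path is proper if the segments at any two different positions are not weakly equal. -/
def IsProper (P : List (PathSegment D X)) : Prop :=
  P.Pairwise fun s t => ¬ s.WeakEq t

end MappingPaths

end VKPath

end

noncomputable section

namespace VKPath

/-! Colimits in `B ⥤ Type w` are computed sortwise as sets of zigzag components, and zigzags lift
along cartesian transformations. Hence `pullbackFunctor κ` is fully faithful for every colimiting
`κ`, and the content is essential surjectivity. This amounts to trivial monodromy: a zigzag in `E`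
whose ends lie over the same element of `D` has equal ends. If closed proper paths are empty,
monodromy is trivial (`IsCartesian.eq_of_connects`): a projected path that is not proper repeats or
reverses a segment, and induction on length lets a piece of the lifted path be cut out. Then `E` is
the pullback of its own object of components (`IsColimiting.exists_iso_pullback`). Conversely, for a
segment `s`, a cartesian cover with fibres of ℤ/2-valued functions is twisted so that crossing `s`
in either direction adds 1. Trivial monodromy makes the parity of crossings of `s` depend only on
the ends of a path (`IsVanKampen.sum_weight_eq`). A proper path crosses each of its segments exactly
once, which forces uniqueness (`IsVanKampen.proper_path_unique`). -/

theorem app_apply_congr {B : Type w} [SmallCategory B] {F G : B ⥤ Type w} {f g : F ⟶ G}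
    (h : f = g) (X : B) (x : F.obj X) : f.app X x = g.app X x := by
  rw [h]

/-! ### Colimits as zigzag components -/

section Components

variable {B : Type w} [SmallCategory B] {I : Type w} [Quiver.{w} I]

/-- Two elements of sort `X` are related if an edge of the diagram maps the first to the second. -/
inductive EdgeRel (D : Diagram I (B ⥤ Type w)) (X : B) : Elem D X → Elem D X → Prop
  | mk {i j : I} (d : i ⟶ j) (x : (D.obj i).obj X) :
      EdgeRel D X ⟨i, x⟩ ⟨j, (D.map d).app X x⟩

/-- The action of a morphism of `B` on elements. -/
def elemMap (D : Diagram I (B ⥤ Type w)) {X Y : B} (f : X ⟶ Y) (y : Elem D X) : Elem D Y :=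
  ⟨y.1, (D.obj y.1).map f y.2⟩

theorem EdgeRel.elemMap {D : Diagram I (B ⥤ Type w)} {X Y : B} (f : X ⟶ Y) {y y' : Elem D X}
    (h : EdgeRel D X y y') : EdgeRel D Y (elemMap D f y) (elemMap D f y') := by
  obtain ⟨d, x⟩ := h
  have := EdgeRel.mk (X := Y) d ((D.obj _).map f x)
  rwa [NatTrans.naturality_apply] at this

/-- The functor of connected components of elements of a diagram. -/
def components (D : Diagram I (B ⥤ Type w)) : B ⥤ Type w where
  obj X := Quot (EdgeRel D X)
  map f := ↾ Quot.map (elemMap D f) fun _ _ h => h.elemMap f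
  map_id X := by
    ext ⟨y⟩
    exact congrArg (Quot.mk _) (by simp [elemMap])
  map_comp f g := by
    ext ⟨y⟩
    exact congrArg (Quot.mk _) (by simp [elemMap]; rfl)

/-- The cocone that sends an element to its component. -/
def toComponents (D : Diagram I (B ⥤ Type w)) : D ⟶ constDiagram.obj (components D) where
  app i :=
    { app := fun X => ↾ fun x => Quot.mk _ ⟨i, x⟩
      naturality := fun _ _ _ => rfl }
  naturality d := by
    ext X x
    exact (Quot.sound (EdgeRel.mk d x)).symm

variable {D : Diagram I (B ⥤ Type w)} {S T : B ⥤ Type w}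

theorem leg_map_apply (κ : D ⟶ constDiagram.obj S) {X : B} {i j : I} (d : i ⟶ j)
    (x : (D.obj i).obj X) :
    (leg κ j).app X ((D.map d).app X x) = (leg κ i).app X x := by
  rw [← map_leg κ d]
  rfl

/-- A cocone as a function on elements. -/
def cone (κ : D ⟶ constDiagram.obj S) (X : B) (y : Elem D X) : S.obj X :=
  (leg κ y.1).app X y.2

theorem EdgeRel.cone_eq (κ : D ⟶ constDiagram.obj S) {X : B} {y y' : Elem D X}
    (h : EdgeRel D X y y') : cone κ X y = cone κ X y' := by
  obtain ⟨d, x⟩ := h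
  exact (leg_map_apply κ d x).symm

theorem cone_eq_of_eqvGen (κ : D ⟶ constDiagram.obj S) {X : B} {y y' : Elem D X}
    (h : Relation.EqvGen (EdgeRel D X) y y') : cone κ X y = cone κ X y' := by
  induction h with
  | rel _ _ h => exact h.cone_eq κ
  | refl => rfl
  | symm _ _ _ ih => exact ih.symm
  | trans _ _ _ _ _ ih₁ ih₂ => exact ih₁.trans ih₂

/-- The morphism from the components induced by a cocone. -/
def componentsDesc (κ : D ⟶ constDiagram.obj S) : components D ⟶ S where
  app X := ↾ Quot.lift (cone κ X) fun _ _ h => h.cone_eq κ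
  naturality X Y f := by
    ext ⟨y⟩
    exact NatTrans.naturality_apply (leg κ y.1) f y.2

theorem toComponents_desc (κ : D ⟶ constDiagram.obj S) :
    toComponents D ≫ constDiagram.map (componentsDesc κ) = κ :=
  rfl

/-- Comparison of `S` with the concrete colimit. The first property makes `κ` jointly surjective;
the second makes elements with the same value in `S` zigzag-connected. -/
theorem IsColimiting.exists_section {κ : D ⟶ constDiagram.obj S} (hκ : IsColimiting κ) :
    ∃ u : S ⟶ components D, u ≫ componentsDesc κ = 𝟙 S ∧
      ∀ (X : B) (y : Elem D X), u.app X (cone κ X y) = Quot.mk _ y := by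
  obtain ⟨u, hu, -⟩ := hκ _ (toComponents D)
  refine ⟨u, ?_, fun X y => ?_⟩
  · refine (hκ S κ).unique ?_ ?_
    · change κ ≫ constDiagram.map u ≫ constDiagram.map (componentsDesc κ) = κ
      rw [← Category.assoc, hu, toComponents_desc]
    · rw [CategoryTheory.Functor.map_id, Category.comp_id]
  · exact congrArg (fun ρ : D ⟶ constDiagram.obj (components D) => (leg ρ y.1).app X y.2) hu

theorem IsColimiting.cone_surjective {κ : D ⟶ constDiagram.obj S} (hκ : IsColimiting κ) {X : B}
    (s : S.obj X) : ∃ y : Elem D X, cone κ X y = s := by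
  obtain ⟨u, hu, -⟩ := hκ.exists_section
  obtain ⟨y, hy⟩ := Quot.exists_rep (u.app X s)
  refine ⟨y, ?_⟩
  have h := congrArg (fun g : S ⟶ S => g.app X s) hu
  change (componentsDesc κ).app X (u.app X s) = s at h
  rw [← hy] at h
  exact h

theorem IsColimiting.eqvGen_of_cone_eq {κ : D ⟶ constDiagram.obj S} (hκ : IsColimiting κ) {X : B}
    {y y' : Elem D X} (h : cone κ X y = cone κ X y') : Relation.EqvGen (EdgeRel D X) y y' := by
  obtain ⟨u, -, hu⟩ := hκ.exists_section
  apply Quot.eqvGen_exact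
  rw [← hu, ← hu, h]

end Components

/-! ### Lifting zigzags along cartesian transformations -/

section Lifting

variable {B : Type w} [SmallCategory B] {I : Type w} [Quiver.{w} I]
  {E D : Diagram I (B ⥤ Type w)}

/-- A natural transformation of diagrams as a function on elements. -/
def elemProj (τ : E ⟶ D) (X : B) (e : Elem E X) : Elem D X :=
  ⟨e.1, (τ.app e.1).app X e.2⟩

theorem app_map_apply (τ : E ⟶ D) {X : B} {i j : I} (d : i ⟶ j) (x : (E.obj i).obj X) :
    (τ.app j).app X ((E.map d).app X x) = (D.map d).app X ((τ.app i).app X x) :=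
  app_apply_congr (τ.naturality d) X x

/-- Zigzags of edges lift along cartesian transformations. -/
theorem IsCartesian.lift_eqvGen {τ : E ⟶ D} (hτ : IsCartesian τ) {X : B} {y y' : Elem D X}
    (h : Relation.EqvGen (EdgeRel D X) y y') (e : Elem E X) (he : elemProj τ X e = y) :
    ∃ e' : Elem E X, elemProj τ X e' = y' ∧ Relation.EqvGen (EdgeRel E X) e e' := by
  -- Lifting from either end is proved simultaneously, since the symmetric case of the induction
  -- exchanges the two directions.
  suffices H : (∀ e, elemProj τ X e = y → ∃ e', elemProj τ X e' = y' ∧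
        Relation.EqvGen (EdgeRel E X) e e') ∧
      ∀ e', elemProj τ X e' = y' → ∃ e, elemProj τ X e = y ∧
        Relation.EqvGen (EdgeRel E X) e' e from H.1 e he
  clear he e
  induction h with
  | rel y y' h =>
    obtain @⟨i, j, d, x⟩ := h
    constructor
    · rintro ⟨i', e⟩ he
      obtain ⟨rfl, hx⟩ := Sigma.mk.inj he
      obtain rfl := eq_of_heq hx
      exact ⟨⟨j, (E.map d).app X e⟩, congrArg (Sigma.mk j) (app_map_apply τ d e),
        .rel _ _ (.mk d e)⟩
    · rintro ⟨j', e'⟩ he'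
      obtain ⟨rfl, hx⟩ := Sigma.mk.inj he'
      -- Only lifting against the direction of an edge needs the pullback property.
      obtain ⟨e, he, rfl⟩ := Types.exists_of_isPullback ((hτ d).app X) e' x (eq_of_heq hx)
      refine ⟨⟨i, e⟩, rfl, .symm _ _ (.rel _ _ ?_)⟩
      exact he ▸ EdgeRel.mk d e
  | refl y => exact ⟨fun e he => ⟨e, he, .refl _⟩, fun e he => ⟨e, he, .refl _⟩⟩
  | symm y y' _ ih => exact ih.symm
  | trans y₁ y₂ y₃ _ _ ih₁ ih₂ =>
    constructor
    · intro e he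
      obtain ⟨e', he', h'⟩ := ih₁.1 e he
      obtain ⟨e'', he'', h''⟩ := ih₂.1 e' he'
      exact ⟨e'', he'', h'.trans _ _ _ h''⟩
    · intro e he
      obtain ⟨e', he', h'⟩ := ih₂.2 e he
      obtain ⟨e'', he'', h''⟩ := ih₁.2 e' he'
      exact ⟨e'', he'', h'.trans _ _ _ h''⟩

end Lifting

/-! ### Universality of colimits and full faithfulness -/

section FullyFaithful

variable {B : Type w} [SmallCategory B] {I : Type w} [Quiver.{w} I]
  {D : Diagram I (B ⥤ Type w)} {S T : B ⥤ Type w} {κ : D ⟶ constDiagram.obj S}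

theorem exists_pullback_elem (κ : D ⟶ constDiagram.obj S) (σ : Over S) {X : B} {i : I}
    (z : (D.obj i).obj X) (k : σ.left.obj X) (h : (leg κ i).app X z = σ.hom.app X k) :
    ∃ p : (pullback (leg κ i) σ.hom).obj X,
      (pullback.fst (leg κ i) σ.hom).app X p = z ∧ (pullback.snd (leg κ i) σ.hom).app X p = k :=
  Types.exists_of_isPullback ((IsPullback.of_hasPullback (leg κ i) σ.hom).app X) z k h

theorem pullback_elem_ext (κ : D ⟶ constDiagram.obj S) (σ : Over S) {X : B} {i : I}
    {p q : (pullback (leg κ i) σ.hom).obj X}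
    (h₁ : (pullback.fst (leg κ i) σ.hom).app X p = (pullback.fst (leg κ i) σ.hom).app X q)
    (h₂ : (pullback.snd (leg κ i) σ.hom).app X p = (pullback.snd (leg κ i) σ.hom).app X q) :
    p = q :=
  Types.ext_of_isPullback ((IsPullback.of_hasPullback (leg κ i) σ.hom).app X) h₁ h₂

/-- The cocone on the pulled back diagram given by the second projections. -/
def pullbackCocone (κ : D ⟶ constDiagram.obj S) (σ : Over S) :
    pullbackDiagram κ σ ⟶ constDiagram.obj σ.left where
  app i := pullback.snd (leg κ i) σ.hom
  naturality d := (pullbackEdge_snd κ σ d).trans (Category.comp_id _).symm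

theorem IsColimiting.pullbackCocone_surjective (hκ : IsColimiting κ) (σ : Over S) {X : B}
    (k : σ.left.obj X) : ∃ p : Elem (pullbackDiagram κ σ) X, cone (pullbackCocone κ σ) X p = k := by
  obtain ⟨⟨i, z⟩, hz⟩ := hκ.cone_surjective (σ.hom.app X k)
  obtain ⟨p, -, hp⟩ := exists_pullback_elem κ σ z k hz
  exact ⟨⟨i, p⟩, hp⟩

/-- The images of `p` and `q` in `D` have the same value in `S`, so a zigzag joins them. Its lift
from `p` ends over the image of `q` and keeps the second projection, so it ends at `q`. With
surjectivity, this makes the second projections a colimiting cocone. -/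
theorem IsColimiting.eqvGen_of_pullbackCocone_eq (hκ : IsColimiting κ) (σ : Over S) {X : B}
    {p q : Elem (pullbackDiagram κ σ) X}
    (hp : cone (pullbackCocone κ σ) X p = cone (pullbackCocone κ σ) X q) :
    Relation.EqvGen (EdgeRel (pullbackDiagram κ σ) X) p q := by
  have hk (r : Elem (pullbackDiagram κ σ) X) :
      cone κ X (elemProj (pullbackProj κ σ) X r) =
        σ.hom.app X (cone (pullbackCocone κ σ) X r) :=
    app_apply_congr (pullback.condition (f := leg κ r.1) (g := σ.hom)) X r.2
  obtain ⟨r, hr, hpr⟩ := (isCartesian_pullbackProj κ σ).lift_eqvGen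
    (hκ.eqvGen_of_cone_eq (y := elemProj (pullbackProj κ σ) X p)
      (y' := elemProj (pullbackProj κ σ) X q) (by rw [hk, hk, hp])) p rfl
  have hrq : cone (pullbackCocone κ σ) X r = cone (pullbackCocone κ σ) X q := by
    rw [← hp, cone_eq_of_eqvGen (pullbackCocone κ σ) hpr]
  obtain ⟨i, r⟩ := r
  obtain ⟨j, q⟩ := q
  obtain ⟨rfl, hf⟩ := Sigma.mk.inj hr
  obtain rfl : r = q := pullback_elem_ext κ σ (eq_of_heq hf) hrq
  exact hpr

theorem IsColimiting.faithful_pullbackFunctor (hκ : IsColimiting κ) :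
    (pullbackFunctor κ).Faithful where
  map_injective {σ σ'} γ γ' h := by
    ext X k
    obtain ⟨⟨i, p⟩, rfl⟩ := hκ.pullbackCocone_surjective σ k
    have hi : pullbackComp κ γ i = pullbackComp κ γ' i :=
      congrArg (fun f : (pullbackFunctor κ).obj σ ⟶ (pullbackFunctor κ).obj σ' =>
        DiagramHom.app f.hom.left i) h
    have h₁ := pullbackComp_snd κ γ i
    rw [hi, pullbackComp_snd] at h₁
    exact app_apply_congr h₁.symm X p

/-- A cocone on the pulled back diagram factors through the total object of the slice. -/
theorem IsColimiting.exists_pullback_desc (hκ : IsColimiting κ) (σ : Over S)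
    (ρ : pullbackDiagram κ σ ⟶ constDiagram.obj T) :
    ∃ γ : σ.left ⟶ T, ∀ i, pullback.snd (leg κ i) σ.hom ≫ γ = leg ρ i := by
  -- The chosen preimages need not be natural in `X`; `key` shows that the value of `ρ` does not
  -- depend on the choice.
  choose p hp using fun (X : B) (k : σ.left.obj X) => hκ.pullbackCocone_surjective σ k
  have key (X : B) (q : Elem (pullbackDiagram κ σ) X) :
      cone ρ X (p X (cone (pullbackCocone κ σ) X q)) = cone ρ X q :=
    cone_eq_of_eqvGen ρ (hκ.eqvGen_of_pullbackCocone_eq σ (hp X _))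
  have nat {R : B ⥤ Type w} (θ : pullbackDiagram κ σ ⟶ constDiagram.obj R) {X Y : B} (f : X ⟶ Y)
      (q : Elem (pullbackDiagram κ σ) X) : cone θ Y (elemMap _ f q) = R.map f (cone θ X q) :=
    NatTrans.naturality_apply (leg θ q.1) f q.2
  refine ⟨{ app := fun X => ↾ fun k => cone ρ X (p X k), naturality := fun X Y f => ?_ },
    fun i => ?_⟩
  · ext k
    change cone ρ Y (p Y (σ.left.map f k)) = T.map f (cone ρ X (p X k))
    rw [← nat, ← key Y (elemMap _ f _), nat, hp]
  · ext X q
    exact key X ⟨i, q⟩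

theorem IsColimiting.full_pullbackFunctor (hκ : IsColimiting κ) :
    (pullbackFunctor κ).Full where
  map_surjective {σ σ'} h := by
    let h' : pullbackDiagram κ σ ⟶ pullbackDiagram κ σ' := h.hom.left
    obtain ⟨c, hc⟩ : ∃ c : ∀ i, pullback (leg κ i) σ.hom ⟶ pullback (leg κ i) σ'.hom,
      c = h'.app := ⟨_, rfl⟩
    have hfst (i : I) : c i ≫ pullback.fst (leg κ i) σ'.hom = pullback.fst (leg κ i) σ.hom := by
      rw [hc]
      exact congrArg (fun g : pullbackDiagram κ σ ⟶ D => DiagramHom.app g i) (Over.w h.hom)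
    obtain ⟨γ, hγ⟩ := hκ.exists_pullback_desc σ (h' ≫ pullbackCocone κ σ')
    replace hγ (i : I) : pullback.snd (leg κ i) σ.hom ≫ γ =
        c i ≫ pullback.snd (leg κ i) σ'.hom := by
      rw [hc]
      exact hγ i
    have hw : γ ≫ σ'.hom = σ.hom := by
      ext X k
      obtain ⟨⟨i, p⟩, rfl⟩ := hκ.pullbackCocone_surjective σ k
      refine app_apply_congr (f := pullback.snd (leg κ i) σ.hom ≫ γ ≫ σ'.hom)
        (g := pullback.snd (leg κ i) σ.hom ≫ σ.hom) ?_ X p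
      rw [← Category.assoc, hγ, Category.assoc, ← pullback.condition, ← pullback.condition,
        ← Category.assoc, hfst]
    refine ⟨Over.homMk γ hw, ?_⟩
    apply ObjectProperty.hom_ext
    apply Over.OverMorphism.ext
    refine DiagramHom.ext (funext fun i => ?_)
    change pullbackComp κ (Over.homMk γ hw) i = h'.app i
    rw [← hc]
    apply pullback.hom_ext
    · rw [pullbackComp_fst, hfst]
    · rw [pullbackComp_snd]
      exact hγ i

end FullyFaithful

/-! ### Mapping paths and monodromy -/

section Paths

variable {B : Type w} [SmallCategory B] {I : Type w} [Quiver.{w} I]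
  {E D : Diagram I (B ⥤ Type w)} {X : B}

/-- The segment of an edge at an element. -/
def PathSegment.forward {i j : I} (d : i ⟶ j) (x : (D.obj i).obj X) : PathSegment D X where
  source := ⟨i, x⟩
  label := Sum.inl ⟨i, j, d⟩
  target := ⟨j, (D.map d).app X x⟩
  valid := ⟨x, rfl, rfl⟩

/-- The segment of the formal opposite of an edge at an element. -/
def PathSegment.backward {i j : I} (d : i ⟶ j) (x : (D.obj i).obj X) : PathSegment D X where
  source := ⟨j, (D.map d).app X x⟩
  label := Sum.inr ⟨i, j, d⟩
  target := ⟨i, x⟩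
  valid := ⟨x, rfl, rfl⟩

theorem PathSegment.eq_forward_or_backward (s : PathSegment D X) :
    (∃ (i j : I) (d : i ⟶ j) (x : (D.obj i).obj X), s = forward d x) ∨
      ∃ (i j : I) (d : i ⟶ j) (x : (D.obj i).obj X), s = backward d x := by
  obtain ⟨y, δ | δ, y', hs⟩ := s
  · obtain ⟨x, rfl, rfl⟩ := hs
    exact .inl ⟨_, _, δ.hom, x, rfl⟩
  · obtain ⟨x, rfl, rfl⟩ := hs
    exact .inr ⟨_, _, δ.hom, x, rfl⟩

theorem connects_append {y y' : Elem D X} {P Q : List (PathSegment D X)} :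
    Connects y (P ++ Q) y' ↔ ∃ z, Connects y P z ∧ Connects z Q y' := by
  induction P generalizing y with
  | nil => exact ⟨fun h => ⟨y, rfl, h⟩, fun ⟨z, hz, h⟩ => by cases hz; exact h⟩
  | cons s P ih =>
    change (_ ∧ Connects _ (P ++ Q) _) ↔ ∃ z, (_ ∧ Connects _ P z) ∧ _
    rw [ih]
    exact ⟨fun ⟨h, z, h₁, h₂⟩ => ⟨z, ⟨h, h₁⟩, h₂⟩, fun ⟨z, ⟨h, h₁⟩, h₂⟩ => ⟨h, z, h₁, h₂⟩⟩

theorem Connects.trans {y₁ y₂ y₃ : Elem D X} {P Q : List (PathSegment D X)}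
    (h₁ : Connects y₁ P y₂) (h₂ : Connects y₂ Q y₃) : Connects y₁ (P ++ Q) y₃ :=
  connects_append.2 ⟨_, h₁, h₂⟩

theorem Connects.exists_reverse {y y' : Elem D X} {P : List (PathSegment D X)}
    (h : Connects y P y') : ∃ Q, Connects y' Q y := by
  induction P generalizing y with
  | nil => exact ⟨[], h.symm⟩
  | cons s P ih =>
    obtain ⟨rfl, h⟩ := h
    obtain ⟨Q, hQ⟩ := ih h
    obtain ⟨i, j, d, x, rfl⟩ | ⟨i, j, d, x, rfl⟩ := s.eq_forward_or_backward
    · exact ⟨Q ++ [.backward d x], hQ.trans (Q := [.backward d x]) ⟨rfl, rfl⟩⟩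
    · exact ⟨Q ++ [.forward d x], hQ.trans (Q := [.forward d x]) ⟨rfl, rfl⟩⟩

theorem exists_connects_of_eqvGen {y y' : Elem D X} (h : Relation.EqvGen (EdgeRel D X) y y') :
    ∃ P, Connects y P y' := by
  induction h with
  | rel y y' h =>
    obtain ⟨d, x⟩ := h
    exact ⟨[.forward d x], rfl, rfl⟩
  | refl y => exact ⟨[], rfl⟩
  | symm y y' _ ih => exact ih.choose_spec.exists_reverse
  | trans y₁ y₂ y₃ _ _ ih₁ ih₂ => exact ⟨_, ih₁.choose_spec.trans ih₂.choose_spec⟩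

/-- The image of a segment under a natural transformation. -/
def PathSegment.proj (τ : E ⟶ D) (s : PathSegment E X) : PathSegment D X where
  source := elemProj τ X s.source
  label := s.label
  target := elemProj τ X s.target
  valid := by
    obtain ⟨i, j, d, x, rfl⟩ | ⟨i, j, d, x, rfl⟩ := s.eq_forward_or_backward
    · exact ⟨(τ.app i).app X x, rfl, congrArg (Sigma.mk j) (app_map_apply τ d x)⟩
    · exact ⟨(τ.app i).app X x, rfl, congrArg (Sigma.mk j) (app_map_apply τ d x)⟩

theorem Connects.proj (τ : E ⟶ D) {e e' : Elem E X} {P : List (PathSegment E X)}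
    (h : Connects e P e') :
    Connects (elemProj τ X e) (P.map (PathSegment.proj τ)) (elemProj τ X e') := by
  induction P generalizing e with
  | nil => exact congrArg _ h
  | cons s P ih => exact ⟨congrArg (elemProj τ X) h.1, ih h.2⟩

/-- Opposite segments over the same edge which start where the other ends are inverse. -/
theorem IsCartesian.source_eq_target {τ : E ⟶ D} (hτ : IsCartesian τ) {s t : PathSegment E X}
    (hst : s.target = t.source) (hlabel : s.label = t.label.swap)
    (hp : elemProj τ X s.source = elemProj τ X t.target) : s.source = t.target := by
  obtain ⟨i, j, d, x, rfl⟩ | ⟨i, j, d, x, rfl⟩ := s.eq_forward_or_backward <;>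
    obtain ⟨i', j', d', x', rfl⟩ | ⟨i', j', d', x', rfl⟩ := t.eq_forward_or_backward
  · cases hlabel
  · cases hlabel
    -- Here `x` and `x'` have the same image along the edge and the same projection to `D`.
    refine congrArg (Sigma.mk i) (Types.ext_of_isPullback ((hτ d).app X) ?_ ?_)
    · exact eq_of_heq (Sigma.mk.inj hst).2
    · exact eq_of_heq (Sigma.mk.inj hp).2
  · cases hlabel
    obtain rfl : x = x' := eq_of_heq (Sigma.mk.inj hst).2
    rfl
  · cases hlabel

theorem exists_of_not_pairwise {α : Type*} {R : α → α → Prop} {l : List α} (h : ¬ l.Pairwise R) :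
    ∃ A s C t F, l = A ++ s :: (C ++ t :: F) ∧ ¬ R s t := by
  induction l with
  | nil => exact absurd .nil h
  | cons a l ih =>
    by_cases hl : l.Pairwise R
    · obtain ⟨t, ht, hat⟩ : ∃ t ∈ l, ¬ R a t := by
        by_contra! H
        exact h (.cons H hl)
      obtain ⟨C, F, rfl⟩ := List.append_of_mem ht
      exact ⟨[], a, C, t, F, rfl, hat⟩
    · obtain ⟨A, s, C, t, F, rfl, hst⟩ := ih hl
      exact ⟨a :: A, s, C, t, F, rfl, hst⟩

/-- If closed proper paths in the base are empty, then cartesian transformations have trivial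
monodromy. -/
theorem IsCartesian.eq_of_connects {τ : E ⟶ D} (hτ : IsCartesian τ)
    (hD : ∀ (y : Elem D X) (P : List (PathSegment D X)), Connects y P y → IsProper P → P = [])
    {e e' : Elem E X} {P : List (PathSegment E X)} (h : Connects e P e')
    (hp : elemProj τ X e = elemProj τ X e') : e = e' := by
  induction hn : P.length using Nat.strong_induction_on generalizing P e e' with
  | _ n ih =>
    by_cases hP : IsProper (P.map (PathSegment.proj τ))
    · have := hD _ _ (hp ▸ h.proj τ) hP
      rw [List.map_eq_nil_iff] at this
      subst this
      exact h
    · rw [IsProper, List.pairwise_map] at hP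
      obtain ⟨A, s, C, t, F, rfl, hst⟩ := exists_of_not_pairwise hP
      obtain ⟨_, hA, rfl, hs⟩ := connects_append.1 h
      obtain ⟨_, hC, rfl, hF⟩ := connects_append.1 hs
      simp only [List.length_append, List.length_cons] at hn
      obtain hst | ⟨h₁, h₂, h₃⟩ := not_not.1 hst
      -- Repeated segment: `s :: C` is a shorter path whose ends have the same projection, so it is
      -- a loop and can be cut out.
      · have hsource : s.source = t.source :=
          ih (C.length + 1) (by omega) (P := s :: C) ⟨rfl, hC⟩
            (congrArg PathSegment.source hst) rfl
        exact ih (A.length + (F.length + 1)) (by omega) (P := A ++ t :: F)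
          (hA.trans ⟨hsource.symm, hF⟩) hp (by simp)
      -- Reversed segment: `C` is a loop by induction, so `s` and `t` backtrack and the whole
      -- stretch from `s` to `t` can be cut out.
      · have htarget : s.target = t.source := ih C.length (by omega) hC h₃ rfl
        have hsource := hτ.source_eq_target htarget h₂ h₁
        exact ih (A.length + F.length) (by omega) (P := A ++ F)
          (hA.trans (hsource ▸ hF)) hp (by simp)

end Paths

section Isomorphisms

variable {I : Type u₁} [Quiver.{v₁} I] {C : Type u} [Category.{v} C] {E D : Diagram I C}

theorem isIso_of_app (τ : E ⟶ D) (h : ∀ i, IsIso (τ.app i)) : IsIso τ := by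
  refine ⟨{ app := fun i => inv (τ.app i), naturality := fun d => ?_ }, ?_, ?_⟩
  · rw [IsIso.eq_inv_comp, ← Category.assoc, IsIso.comp_inv_eq]
    exact (τ.naturality d).symm
  · exact DiagramHom.ext (funext fun i => IsIso.hom_inv_id (τ.app i))
  · exact DiagramHom.ext (funext fun i => IsIso.inv_hom_id (τ.app i))

end Isomorphisms

/-! ### Path uniqueness gives essential surjectivity -/

section Sufficiency

variable {B : Type w} [SmallCategory B] {I : Type w} [Quiver.{w} I]
  {D : Diagram I (B ⥤ Type w)} {S : B ⥤ Type w} {κ : D ⟶ constDiagram.obj S}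

theorem isIso_of_bijective {F G : B ⥤ Type w} (f : F ⟶ G)
    (h : ∀ X, Function.Bijective (f.app X)) : IsIso f := by
  have (X : B) : IsIso (f.app X) := (isIso_iff_bijective _).2 (h X)
  exact NatIso.isIso_of_isIso_app f

/-- The witness is the object of components of `E` over `S`. The comparison with its pullback is
injective by trivial monodromy and surjective by lifting zigzags. -/
theorem IsColimiting.exists_iso_pullback (hκ : IsColimiting κ)
    (hD : ∀ (X : B) (y : Elem D X) (P : List (PathSegment D X)),
      Connects y P y → IsProper P → P = [])
    {E : Diagram I (B ⥤ Type w)} {τ : E ⟶ D} (hτ : IsCartesian τ) :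
    ∃ (σ : Over S) (h : E ⟶ pullbackDiagram κ σ), IsIso h ∧ h ≫ pullbackProj κ σ = τ := by
  let σ : Over S := Over.mk (componentsDesc (τ ≫ κ))
  have hw (i : I) : τ.app i ≫ leg κ i = leg (toComponents E) i ≫ σ.hom := rfl
  let c (i : I) : E.obj i ⟶ pullback (leg κ i) σ.hom :=
    pullback.lift (τ.app i) (leg (toComponents E) i) (hw i)
  have hfst (i : I) : c i ≫ pullback.fst (leg κ i) σ.hom = τ.app i := pullback.lift_fst _ _ _
  have hsnd (i : I) : c i ≫ pullback.snd (leg κ i) σ.hom = leg (toComponents E) i :=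
    pullback.lift_snd _ _ _
  have hnat {i j : I} (d : i ⟶ j) : E.map d ≫ c j = c i ≫ pullbackEdge κ σ d := by
    apply pullback.hom_ext
    · rw [Category.assoc, Category.assoc, pullbackEdge_fst, hfst, ← Category.assoc, hfst]
      exact τ.naturality d
    · rw [Category.assoc, Category.assoc, pullbackEdge_snd, hsnd, hsnd, map_leg]
  have hiso (i : I) : IsIso (c i) := by
    refine isIso_of_bijective _ fun X => ⟨fun e e' h => ?_, fun p => ?_⟩
    · have h₁ : (τ.app i).app X e = (τ.app i).app X e' := by
        rw [← hfst i]
        exact congrArg ((pullback.fst (leg κ i) σ.hom).app X) h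
      have h₂ : (leg (toComponents E) i).app X e = (leg (toComponents E) i).app X e' := by
        rw [← hsnd i]
        exact congrArg ((pullback.snd (leg κ i) σ.hom).app X) h
      obtain ⟨P, hP⟩ := exists_connects_of_eqvGen (Quot.eqvGen_exact h₂)
      have := hτ.eq_of_connects (hD X) hP (congrArg (Sigma.mk i) h₁)
      exact eq_of_heq (Sigma.mk.inj this).2
    · obtain ⟨e, he⟩ := Quot.exists_rep ((pullback.snd (leg κ i) σ.hom).app X p)
      have hp := app_apply_congr (pullback.condition (f := leg κ i) (g := σ.hom)) X p
      have hcone : cone κ X (elemProj τ X e) =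
          cone κ X ⟨i, (pullback.fst (leg κ i) σ.hom).app X p⟩ := by
        refine Eq.trans ?_ hp.symm
        exact congrArg (σ.hom.app X) he
      obtain ⟨⟨j, e'⟩, he', hee'⟩ := hτ.lift_eqvGen (hκ.eqvGen_of_cone_eq hcone) e rfl
      obtain ⟨rfl, hx⟩ := Sigma.mk.inj he'
      refine ⟨e', pullback_elem_ext κ σ ?_ ?_⟩
      · exact (app_apply_congr (hfst j) X e').trans (eq_of_heq hx)
      · refine (app_apply_congr (hsnd j) X e').trans (Eq.trans ?_ he)
        exact (Quot.eqvGen_sound hee').symm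
  exact ⟨σ, { app := c, naturality := hnat }, isIso_of_app _ hiso, DiagramHom.ext (funext hfst)⟩

theorem IsColimiting.essSurj_pullbackFunctor (hκ : IsColimiting κ)
    (hD : ∀ (X : B) (y : Elem D X) (P : List (PathSegment D X)),
      Connects y P y → IsProper P → P = []) :
    (pullbackFunctor κ).EssSurj where
  mem_essImage τ := by
    obtain ⟨σ, h, hiso, hw⟩ := hκ.exists_iso_pullback hD τ.property
    let φ : τ.obj ≅ Over.mk (pullbackProj κ σ) :=
      Over.isoMk (@asIso _ _ _ _ h hiso) hw
    exact ⟨σ, ⟨ObjectProperty.isoMk _ φ.symm⟩⟩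

end Sufficiency

/-! ### Twisted covers and crossing parities -/

section Necessity

variable {B : Type w} [SmallCategory B] {I : Type w} [Quiver.{w} I]
  {D : Diagram I (B ⥤ Type w)} {S : B ⥤ Type w} {κ : D ⟶ constDiagram.obj S}

/-- Cartesian transformations over a Van Kampen cocone have trivial monodromy. -/
theorem IsVanKampen.eq_of_eqvGen (hκ : IsVanKampen κ) {E : Diagram I (B ⥤ Type w)} {τ : E ⟶ D}
    (hτ : IsCartesian τ) {X : B} {e e' : Elem E X} (h : Relation.EqvGen (EdgeRel E X) e e')
    (hp : elemProj τ X e = elemProj τ X e') : e = e' := by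
  have : (pullbackFunctor κ).IsEquivalence := hκ
  obtain ⟨σ, ⟨φ⟩⟩ := Functor.EssSurj.mem_essImage (F := pullbackFunctor κ) ⟨Over.mk τ, hτ⟩
  let g : pullbackDiagram κ σ ⟶ E := φ.hom.hom.left
  let f : E ⟶ pullbackDiagram κ σ := φ.inv.hom.left
  have hfg : f ≫ g = 𝟙 E :=
    congrArg (fun θ : (⟨Over.mk τ, hτ⟩ : CartesianOver D) ⟶ ⟨Over.mk τ, hτ⟩ => θ.hom.left)
      φ.inv_hom_id
  have hf : f ≫ pullbackProj κ σ = τ := Over.w φ.inv.hom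
  -- In a pulled back diagram, connected elements share their second projection, so those over the
  -- same element of `D` coincide; the isomorphism carries this to `E`.
  have hk := cone_eq_of_eqvGen (f ≫ pullbackCocone κ σ) h
  obtain ⟨i, e⟩ := e
  obtain ⟨j, e'⟩ := e'
  obtain ⟨rfl, hx⟩ := Sigma.mk.inj hp
  replace hx := eq_of_heq hx
  rw [← hf] at hx
  have hinj : (f.app i).app X e = (f.app i).app X e' := pullback_elem_ext κ σ hx hk
  have hid (x : (E.obj i).obj X) : (g.app i).app X ((f.app i).app X x) = x :=
    app_apply_congr (congrArg (fun θ : E ⟶ E => θ.app i) hfg) X x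
  rw [← hid e, ← hid e', hinj]

variable {X : B}

/-- The double cover of a diagram coinduced from a cocycle on its elements of sort `X`. -/
def twist (D : Diagram I (B ⥤ Type w)) (X : B)
    (c : ∀ {i j : I}, (i ⟶ j) → (D.obj i).obj X → ZMod 2) : Diagram I (B ⥤ Type w) where
  obj i :=
    -- A label for every `f : Y ⟶ X` makes the cover functorial although `c` lives in sort `X` alone
    -- and satisfies no naturality. In sort `X`, evaluation at `𝟙 X` gives the ℤ/2-label of
    -- interest.
    { obj := fun Y => (D.obj i).obj Y × ((Y ⟶ X) → ZMod 2)
      map := fun g => ↾ fun p => ((D.obj i).map g p.1, fun f => p.2 (g ≫ f))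
      map_id := fun Y => by ext p <;> simp
      map_comp := fun f g => by ext p <;> simp }
  map {i j} d :=
    { app := fun Y => ↾ fun p =>
        ((D.map d).app Y p.1, fun f => p.2 f + c d ((D.obj i).map f p.1))
      naturality := fun Y Z g => by
        ext p
        · exact NatTrans.naturality_apply (D.map d) g p.1
        · next f =>
          change p.2 (g ≫ f) + c d ((D.obj i).map f ((D.obj i).map g p.1)) =
            p.2 (g ≫ f) + c d ((D.obj i).map (g ≫ f) p.1)
          rw [Functor.map_comp_apply] }

/-- The projection of the double cover. -/
def twistProj (D : Diagram I (B ⥤ Type w)) (X : B)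
    (c : ∀ {i j : I}, (i ⟶ j) → (D.obj i).obj X → ZMod 2) : twist D X c ⟶ D where
  app _ := { app := fun Y => ↾ fun p : _ × ((Y ⟶ X) → ZMod 2) => p.1, naturality := fun _ _ _ => rfl }
  naturality _ := rfl

theorem isCartesian_twistProj (D : Diagram I (B ⥤ Type w)) (X : B)
    (c : ∀ {i j : I}, (i ⟶ j) → (D.obj i).obj X → ZMod 2) : IsCartesian (twistProj D X c) := by
  intro i j d
  refine IsPullback.of_forall_isPullback_app fun Y => ?_
  rw [Types.isPullback_iff]
  refine ⟨rfl, ?_, ?_⟩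
  · rintro ⟨x, φ⟩ ⟨x', φ'⟩ ⟨h, hx⟩
    obtain rfl : x = x' := hx
    refine Prod.ext rfl (funext fun f => ?_)
    exact add_right_cancel (congrFun (congrArg Prod.snd h) f)
  · rintro ⟨y, φ⟩ x hx
    obtain rfl : y = (D.map d).app Y x := hx
    refine ⟨(x, fun f => φ f - c d ((D.obj i).map f x)), ?_, rfl⟩
    exact Prod.ext rfl (funext fun f => sub_add_cancel _ _)

/-- The elements of sort `X` of the double cover. -/
def twistElem {D : Diagram I (B ⥤ Type w)} {X : B}
    (c : ∀ {i j : I}, (i ⟶ j) → (D.obj i).obj X → ZMod 2) (y : Elem D X)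
    (φ : (X ⟶ X) → ZMod 2) : Elem (twist D X c) X :=
  ⟨y.1, (y.2, φ)⟩

theorem edgeRel_twist {D : Diagram I (B ⥤ Type w)} {X : B}
    (c : ∀ {i j : I}, (i ⟶ j) → (D.obj i).obj X → ZMod 2) {i j : I} (d : i ⟶ j)
    (x : (D.obj i).obj X) (φ : (X ⟶ X) → ZMod 2) :
    EdgeRel (twist D X c) X (twistElem c ⟨i, x⟩ φ)
      (twistElem c ⟨j, (D.map d).app X x⟩ fun f => φ f + c d ((D.obj i).map f x)) :=
  EdgeRel.mk (D := twist D X c) (X := X) d (x, φ)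

open Classical in
/-- The indicator modulo two of the segments weakly equal to `s`. -/
def weight (s t : PathSegment D X) : ZMod 2 :=
  if s.WeakEq t then 1 else 0

/-- Reversal merely exchanges the two alternatives of weak equality, so `weight` ignores
orientation. -/
theorem PathSegment.weakEq_forward_iff (s : PathSegment D X) {i j : I} (d : i ⟶ j)
    (x : (D.obj i).obj X) : s.WeakEq (.forward d x) ↔ s.WeakEq (.backward d x) := by
  have h₁ (t : PathSegment D X) : t = .forward d x ↔ t.source = ⟨i, x⟩ ∧
      t.label = .inl ⟨i, j, d⟩ ∧ t.target = ⟨j, (D.map d).app X x⟩ := by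
    refine ⟨fun h => h ▸ ⟨rfl, rfl, rfl⟩, fun h => ?_⟩
    obtain ⟨_, _, _, _⟩ := t
    obtain ⟨rfl, rfl, rfl⟩ := h
    rfl
  have h₂ (t : PathSegment D X) : t = .backward d x ↔ t.source = ⟨j, (D.map d).app X x⟩ ∧
      t.label = .inr ⟨i, j, d⟩ ∧ t.target = ⟨i, x⟩ := by
    refine ⟨fun h => h ▸ ⟨rfl, rfl, rfl⟩, fun h => ?_⟩
    obtain ⟨_, _, _, _⟩ := t
    obtain ⟨rfl, rfl, rfl⟩ := h
    rfl
  unfold WeakEq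
  rw [h₁, h₂]
  exact or_comm

theorem weight_backward (s : PathSegment D X) {i j : I} (d : i ⟶ j) (x : (D.obj i).obj X) :
    weight s (.backward d x) = weight s (.forward d x) :=
  open Classical in if_congr (s.weakEq_forward_iff d x).symm rfl rfl

/-- Segments lift to the double cover twisted at `s`. -/
theorem exists_lift_segment (s t : PathSegment D X) (φ : (X ⟶ X) → ZMod 2) :
    ∃ φ' : (X ⟶ X) → ZMod 2, φ' (𝟙 X) = φ (𝟙 X) + weight s t ∧
      Relation.EqvGen (EdgeRel (twist D X fun d x => weight s (.forward d x)) X)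
        (twistElem (fun d x => weight s (.forward d x)) t.source φ)
        (twistElem (fun d x => weight s (.forward d x)) t.target φ') := by
  obtain ⟨i, j, d, x, rfl⟩ | ⟨i, j, d, x, rfl⟩ := t.eq_forward_or_backward
  · refine ⟨fun f => φ f + weight s (.forward d ((D.obj i).map f x)), ?_, ?_⟩
    · simp
    · exact .rel _ _ (edgeRel_twist (fun d x => weight s (.forward d x)) d x φ)
  · refine ⟨fun f => φ f + weight s (.forward d ((D.obj i).map f x)), ?_, ?_⟩
    · simp [weight_backward]
    · have h := edgeRel_twist (fun d x => weight s (.forward d x)) d x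
        fun f => φ f + weight s (.forward d ((D.obj i).map f x))
      -- In characteristic two, crossing backwards adds the same amount as crossing forwards.
      simp only [add_assoc, CharTwo.add_self_eq_zero, add_zero] at h
      exact .symm _ _ (.rel _ _ h)

theorem Connects.exists_lift (s : PathSegment D X) {y y' : Elem D X}
    {P : List (PathSegment D X)} (h : Connects y P y') (φ : (X ⟶ X) → ZMod 2) :
    ∃ φ' : (X ⟶ X) → ZMod 2, φ' (𝟙 X) = φ (𝟙 X) + (P.map (weight s)).sum ∧
      Relation.EqvGen (EdgeRel (twist D X fun d x => weight s (.forward d x)) X)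
        (twistElem (fun d x => weight s (.forward d x)) y φ)
        (twistElem (fun d x => weight s (.forward d x)) y' φ') := by
  induction P generalizing y φ with
  | nil =>
    cases h
    exact ⟨φ, by simp, .refl _⟩
  | cons t P ih =>
    obtain ⟨rfl, h⟩ := h
    obtain ⟨φ₁, hφ₁, h₁⟩ := exists_lift_segment s t φ
    obtain ⟨φ₂, hφ₂, h₂⟩ := ih h φ₁
    exact ⟨φ₂, by rw [hφ₂, hφ₁, List.map_cons, List.sum_cons, add_assoc], h₁.trans _ _ _ h₂⟩

/-- Lifts of both paths from the label 0 in the cover twisted at `s` have connected ends over `y'`.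
Trivial monodromy identifies these ends, and their labels at `𝟙 X` are the two sums. -/
theorem IsVanKampen.sum_weight_eq (hκ : IsVanKampen κ) (s : PathSegment D X) {y y' : Elem D X}
    {P Q : List (PathSegment D X)} (hP : Connects y P y') (hQ : Connects y Q y') :
    (P.map (weight s)).sum = (Q.map (weight s)).sum := by
  obtain ⟨φ₁, h₁, hφ₁⟩ := hP.exists_lift s 0
  obtain ⟨φ₂, h₂, hφ₂⟩ := hQ.exists_lift s 0
  have h := hκ.eq_of_eqvGen (isCartesian_twistProj D X fun d x => weight s (.forward d x))
    (.trans _ _ _ (.symm _ _ hφ₁) hφ₂) rfl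
  have h' : φ₁ = φ₂ := congrArg Prod.snd (eq_of_heq (Sigma.mk.inj h).2)
  rw [h', h₂] at h₁
  exact (add_left_cancel h₁).symm

theorem sum_weight_eq_zero {s : PathSegment D X} {P : List (PathSegment D X)}
    (h : ∀ t ∈ P, ¬ s.WeakEq t) : (P.map (weight s)).sum = 0 := by
  apply List.sum_eq_zero
  intro a ha
  obtain ⟨t, ht, rfl⟩ := List.mem_map.1 ha
  exact if_neg (h t ht)

theorem IsProper.sum_weight_head {s : PathSegment D X} {P : List (PathSegment D X)}
    (h : IsProper (s :: P)) : ((s :: P).map (weight s)).sum = 1 := by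
  rw [List.map_cons, List.sum_cons, sum_weight_eq_zero (List.pairwise_cons.1 h).1, add_zero]
  exact if_pos (.inl rfl)

theorem IsVanKampen.eq_nil_of_closed (hκ : IsVanKampen κ) {y : Elem D X}
    {P : List (PathSegment D X)} (h : Connects y P y) (hP : IsProper P) : P = [] := by
  cases P with
  | nil => rfl
  | cons s P =>
    have := hκ.sum_weight_eq s h (Q := []) rfl
    rw [hP.sum_weight_head] at this
    exact absurd this one_ne_zero

/-- The head `s` of `P` has odd parity, so `Q` contains some `t` weakly equal to `s`. If `t = s`,
the part of `Q` before it is closed, hence empty, and the heads cancel. If `t` is the reverse of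
`s`, the part of `Q` up to and including `t` is a nonempty closed proper path, which is impossible.
-/
theorem IsVanKampen.proper_path_unique (hκ : IsVanKampen κ) {y y' : Elem D X}
    {P Q : List (PathSegment D X)} (hP : Connects y P y') (hP' : IsProper P)
    (hQ : Connects y Q y') (hQ' : IsProper Q) : P = Q := by
  induction P generalizing y Q with
  | nil =>
    cases hP
    exact (hκ.eq_nil_of_closed hQ hQ').symm
  | cons s P ih =>
    have hs := hκ.sum_weight_eq s hP hQ
    rw [hP'.sum_weight_head] at hs
    obtain ⟨t, ht, hst⟩ : ∃ t ∈ Q, s.WeakEq t := by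
      by_contra! H
      rw [sum_weight_eq_zero H] at hs
      exact one_ne_zero hs
    obtain ⟨A, C, rfl⟩ := List.append_of_mem ht
    obtain ⟨_, hA, rfl, hC⟩ := connects_append.1 hQ
    obtain ⟨rfl, hP⟩ := hP
    have hA' : IsProper A := (List.pairwise_append.1 hQ').1
    obtain rfl | ⟨h, -, -⟩ := hst
    · obtain rfl := hκ.eq_nil_of_closed hA hA'
      rw [ih hP (List.pairwise_cons.1 hP').2 hC (List.pairwise_cons.1 hQ').2, List.nil_append]
    · have hclosed : Connects s.source (A ++ [t]) s.source := hA.trans ⟨rfl, h.symm⟩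
      have hproper : IsProper (A ++ [t]) :=
        List.Pairwise.sublist (.append_left (.cons_cons t (List.nil_sublist C)) A) hQ'
      have := hκ.eq_nil_of_closed hclosed hproper
      simp at this

end Necessity

end VKPath

end

theorem theorem3p3 {B : Type w} [CategoryTheory.SmallCategory B] {I : Type w} [Quiver.{w} I]
    (D : VKPath.Diagram I (B ⥤ Type w)) (S : B ⥤ Type w)
    (κ : D ⟶ VKPath.constDiagram.obj S) (hκ : VKPath.IsColimiting κ) :
    VKPath.IsVanKampen κ ↔
      ∀ (X : B) (i j : I) (z : (D.obj i).obj X) (z' : (D.obj j).obj X),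
        ¬ ∃ P Q : List (VKPath.PathSegment D X), P ≠ Q ∧
          (VKPath.Connects ⟨i, z⟩ P ⟨j, z'⟩ ∧ VKPath.IsProper P) ∧
          (VKPath.Connects ⟨i, z⟩ Q ⟨j, z'⟩ ∧ VKPath.IsProper Q) := by
  constructor
  · rintro h X i j z z' ⟨P, Q, hPQ, ⟨hP, hP'⟩, hQ, hQ'⟩
    exact hPQ (h.proper_path_unique hP hP' hQ hQ')
  · intro h
    have := hκ.faithful_pullbackFunctor
    have := hκ.full_pullbackFunctor
    have := hκ.essSurj_pullbackFunctor fun X y P hP hP' => by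
      by_contra hne
      -- Uniqueness is needed only for closed paths, compared with the empty path.
      exact h X y.1 y.1 y.2 y.2 ⟨P, [], hne, ⟨hP, hP'⟩, rfl, .nil⟩
    exact { }
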